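/- Let $d\in\mathbb N$, let $A=(a_{ij})$ be any complex $d\times d$ matrix with diagonal entries $a_1,\dots,a_d$, let $b\in\mathbb C^d$ and $B=\operatorname{diag}(b_1,\dots,b_d)$. Let $S=\mathbb C\times\{1,\dots,d\}$, let $C(S,\mathbb C)$ be the space of continuous functions on $S$ with the topology of uniform convergence on compact sets, and put, for $f\in C(S,\mathbb C)$ and $c,r\in\mathbb C^d$, $$\mathcal A f(\zeta,i)=\sum_{j\neq i}\bigl(f(\zeta a_{ij},j)-f(\zeta,i)\bigr),\qquad V^c f(\zeta,i)=c_i f(\zeta,i),\qquad f^r(\zeta,i)=\zeta r_i .$$ For each $(\zeta,i)\in S$ let $(Y_t^{(\zeta,i)})_{t\ge 0}=(Z_t^{(\zeta,i)},X_t^{(\zeta,i)})_{t\ge0}$ be a càdlàg $S$-valued Markov process, on some filtered probability space, that starts at $(\zeta,i)$ and has generator $\mathcal A$, i.e. $E[f(Y_{s+t})\mid\mathcal F_s]=(\kappa_tf)(Y_s)$ for a Markov transition semigroup $(\kappa_t)_{t\ge0}$ with $(\kappa_t f-f)/t\to\mathcal A f$ uniformly on $S$ as $t\downarrow0$, for every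 bounded continuous $f$. For $z\in\mathbb C$, $r\in\mathbb C^d$, $t\ge0$ put $$u_t^r(\zeta,i)=E\Bigl(\exp\Bigl(\int_0^t a_{X_s^{(\zeta,i)}}\,ds-z\int_0^t b_{X_s^{(\zeta,i)}}\,ds\Bigr)f^r\bigl(Y_t^{(\zeta,i)}\bigr)\Bigr).$$ Then, for all $z\in\mathbb C$ and $r\in\mathbb C^d$, this expectation exists for all $t\ge0$ and $(\zeta,i)\in S$, the functions $u_t^r$ belong to $C(S,\mathbb C)$, and $t\mapsto u_t^r$ solves in $C(S,\mathbb C)$, for all $t\ge 0$, the differential equation $$\frac{\partial}{\partial t}u_t=\mathcal A u_t+V^a u_t-zV^b u_t,\qquad u_0=f^r ,$$ where $a=(a_1,\dots,a_d)$. On the other hand, $t\mapsto e^{-t(d-1)}f^{\exp(t(A-zB))r}$ is a solution of this initial value problem, and it is the only one with values in the space $\{f^\rho:\rho\in\mathbb C^d\}$. Hence, for all $t\ge0$ and $i\in\{1,\dots,d\}$, $$u_t^r(1,i)=E\Bigl(\exp\Bigl(\int_0^t a_{X_s^{(1,i)}}\,ds-z\int_0^t b_{X_s^{(1,i)}}\,ds\Bigr)f^r\bigl(Y_t^{(1,i)}\bigr)\Bigr)=e^{-t(d-1)}\bigl(\exp(t(A-zB))r\bigr)_i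 .$$ -/

import Mathlib

open MeasureTheory ProbabilityTheory Filter Topology
open scoped NNReal BoundedContinuousFunction

noncomputable section

/-- The state space `S = ℂ × {1, …, d}` (indices in `Fin d`), with the product topology and the
product (that is, Borel) σ-algebra. -/
abbrev JumpState (d : ℕ) : Type := ℂ × Fin d

/-- The operator `𝒜 f (ζ, i) = ∑_{j ≠ i} (f (ζ a_{ij}, j) - f (ζ, i))` on `C(S, ℂ)`. -/
def jumpGenerator {d : ℕ} (A : Matrix (Fin d) (Fin d) ℂ) (f : C(JumpState d, ℂ)) :
    C(JumpState d, ℂ) where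
  toFun x := ∑ j ∈ Finset.univ.erase x.2, (f (x.1 * A x.2 j, j) - f x)
  continuous_toFun := by
    refine continuous_prod_of_discrete_right.2 fun i => ?_
    change Continuous fun ζ : ℂ => ∑ j ∈ Finset.univ.erase i, (f (ζ * A i j, j) - f (ζ, i))
    fun_prop

/-- Multiplication by the potential `V^b (ζ, i) = b_i` on `C(S, ℂ)`. -/
def potentialMul {d : ℕ} (b : Fin d → ℂ) (f : C(JumpState d, ℂ)) : C(JumpState d, ℂ) where
  toFun x := b x.2 * f x
  continuous_toFun := by
    have h : Continuous b := continuous_of_discreteTopology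
    fun_prop

/-- The function `f^r (ζ, i) = ζ r_i` on `S`. -/
def linearFun {d : ℕ} (r : Fin d → ℂ) : C(JumpState d, ℂ) where
  toFun x := x.1 * r x.2
  continuous_toFun := by
    have h : Continuous r := continuous_of_discreteTopology
    fun_prop

/-- A (time-homogeneous) Markov transition semigroup on a measurable space `E`: Markov kernels
`κ t`, `t ≥ 0`, with `κ 0` the identity kernel and the Chapman–Kolmogorov equations. -/
structure IsTransitionSemigroup {E : Type*} [MeasurableSpace E] (κ : ℝ≥0 → Kernel E E) :
    Prop where
  markov : ∀ t, IsMarkovKernel (κ t)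
  zero : κ 0 = Kernel.id
  add : ∀ s t, κ (s + t) = κ t ∘ₖ κ s

/-- The operator `L` is the infinitesimal generator of the transition semigroup `κ`, on bounded
continuous functions: `(κ_t f - f) / t → L f` uniformly on the state space as `t ↓ 0`. -/
def HasInfinitesimalGenerator {E : Type*} [TopologicalSpace E] [MeasurableSpace E]
    (κ : ℝ≥0 → Kernel E E) (L : C(E, ℂ) → C(E, ℂ)) : Prop :=
  ∀ f : E →ᵇ ℂ,
    TendstoUniformly (fun (t : ℝ≥0) (x : E) => (t : ℂ)⁻¹ * ((∫ y, f y ∂(κ t x)) - f x))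
      (fun x => L f.toContinuousMap x) (𝓝[>] 0)

/-- Right-continuous paths with left limits. -/
def IsCadlagPath {E : Type*} [TopologicalSpace E] (p : ℝ≥0 → E) : Prop :=
  ∀ t, ContinuousWithinAt p (Set.Ici t) t ∧ ∃ l, Tendsto p (𝓝[<] t) (𝓝 l)

/-- On the filtered probability space `(Ω, ℱ, P)`, the `E`-valued process `Y` is a càdlàg Markov
process started at `x` whose transition semigroup has infinitesimal generator `L`. -/
structure IsMarkovProcessWithGenerator {E : Type*} [TopologicalSpace E] [MeasurableSpace E]
    (L : C(E, ℂ) → C(E, ℂ)) (x : E) {Ω : Type*} {m : MeasurableSpace Ω} (P : Measure Ω)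
    (ℱ : Filtration ℝ≥0 m) (Y : ℝ≥0 → Ω → E) : Prop where
  isProbabilityMeasure : IsProbabilityMeasure P
  /-- `Y t` is measurable with respect to `ℱ t`. -/
  adapted : ∀ t, Measurable[ℱ t] (Y t)
  cadlag : ∀ᵐ ω ∂P, IsCadlagPath fun t => Y t ω
  initial : ∀ᵐ ω ∂P, Y 0 ω = x
  /-- `E[f(Y_{s+t}) | ℱ_s] = (κ_t f)(Y_s)` for a transition semigroup `κ` with generator `L`. -/
  markov : ∃ κ : ℝ≥0 → Kernel E E, IsTransitionSemigroup κ ∧ HasInfinitesimalGenerator κ L ∧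
    ∀ (s t : ℝ≥0) (f : E →ᵇ ℂ),
      P[fun ω => f (Y (s + t) ω) | ℱ s] =ᵐ[P] fun ω => ∫ y, f y ∂(κ t (Y s ω))

/-- The random variable
`exp (∫_0^t a(X_s) ds - z ∫_0^t b(X_s) ds) f^r(Y_t)`, where `Y = (Z, X)`. -/
def feynmanKacFunctional {d : ℕ} (a b : Fin d → ℂ) (z : ℂ) (r : Fin d → ℂ) {Ω : Type*}
    (Y : ℝ≥0 → Ω → JumpState d) (t : ℝ) (ω : Ω) : ℂ :=
  Complex.exp ((∫ s in (0 : ℝ)..t, a (Y s.toNNReal ω).2) -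
      z * ∫ s in (0 : ℝ)..t, b (Y s.toNNReal ω).2) *
    linearFun r (Y t.toNNReal ω)

/-- `u : [0, ∞) → C(S, ℂ)` (values at negative times play no role) solves
`∂u_t/∂t = 𝒜 u_t + V^a u_t - z V^b u_t`, `u_0 = f`, where `a` is the diagonal of `A`. The
derivative (one-sided at `t = 0`) is taken in `C(S, ℂ)` with the topology of uniform convergence
on compact sets. -/
def IsEvolutionSolution {d : ℕ} (A : Matrix (Fin d) (Fin d) ℂ) (b : Fin d → ℂ) (z : ℂ)
    (f : C(JumpState d, ℂ)) (u : ℝ → C(JumpState d, ℂ)) : Prop :=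
  u 0 = f ∧ ∀ t : ℝ, 0 ≤ t →
    HasDerivWithinAt u
      (jumpGenerator A (u t) + potentialMul A.diag (u t) - z • potentialMul b (u t))
      (Set.Ici 0) t

end

/-!
Everything reduces to the identity `E[feynmanKacFunctional] = e^{-t(d-1)} ζ (exp(t(A - zB)) r)_i`
for the process started at an arbitrary `(ζ, i)`. Once it is known, the remaining assertions are
about the linear ordinary differential equation `ρ' = (A - zB - (d - 1)) ρ` on `ℂ^d`, because `𝒜`
and the potentials preserve the space of the functions `f^ρ` (`evolution_linearFun`), because
`ρ ↦ f^ρ` is continuous and linear, and because `ρ` is recovered from `f^ρ` by evaluation at the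
points `(1, i)`.

*The semigroup.* The operator `𝒜` is bounded on bounded continuous functions, so a transition
semigroup with generator `𝒜` is `κ_t = exp(t𝒜)` there
(`IsTransitionSemigroup.integral_eq_exp`). The functions `f^ρ` are unbounded, but `𝒜` preserves
bounds of the form `|f(ζ, i)| ≤ c |ζ|` up to a constant factor. Hence `E|Z_t| < ∞`, and
dominated convergence in the exponential series yields the Markov property for `f^ρ`, on which `κ_t`
acts by `ρ ↦ exp(t Q) ρ` with `Q = jumpMatrix A`
(`IsMarkovProcessWithGenerator.integral_mul_linearFun`).

*The Feynman–Kac formula.* With the time integral replaced by a Riemann sum of mesh `h = t / n`, the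
exponential becomes a product of weights `e^{h V(X_{kh})}`, `V = a - zb`, and conditioning step by
step turns the expectation into `f^ρ` with `ρ = (e^{hQ} e^{h diag V})^n r`. As `n → ∞` the
functional converges by dominated convergence, since càdlàg paths are right-continuous
(`IsCadlagPath.tendsto_riemannSum`), and the matrices converge to
`exp(t (Q + diag V)) = e^{-t(d-1)} exp(t(A - zB))` by the Lie–Trotter product formula
(`tendsto_exp_mul_exp_pow`).
-/

/-! ### Transition semigroups with a bounded generator -/

/-- If the generator is the bounded operator `T` on bounded continuous functions, then
`κ_h f = f + h T f + o(h)`, uniformly on the state space. -/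
theorem HasInfinitesimalGenerator.eventually_norm_integral_sub_le {E : Type*}
    [TopologicalSpace E] [MeasurableSpace E] {κ : ℝ≥0 → Kernel E E} {L : C(E, ℂ) → C(E, ℂ)}
    (hL : HasInfinitesimalGenerator κ L) (T : (E →ᵇ ℂ) →L[ℂ] (E →ᵇ ℂ))
    (hT : ∀ f : E →ᵇ ℂ, ∀ x, T f x = L f.toContinuousMap x) (f : E →ᵇ ℂ) {ε : ℝ} (hε : 0 < ε) :
    ∀ᶠ h : ℝ in 𝓝[>] 0, ∀ y,
      ‖(∫ w, f w ∂(κ h.toNNReal y)) - (f + (h : ℂ) • T f) y‖ ≤ ε * h := by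
  have h1 := Metric.tendstoUniformly_iff.1 (hL f) ε hε
  have h2 : Tendsto Real.toNNReal (𝓝[>] (0 : ℝ)) (𝓝[>] (0 : ℝ≥0)) := by
    refine tendsto_nhdsWithin_iff.2 ⟨?_, ?_⟩
    · have := (continuous_real_toNNReal.tendsto 0).mono_left (nhdsWithin_le_nhds (s := Set.Ioi 0))
      simpa using this
    · filter_upwards [self_mem_nhdsWithin] with h hh
      simpa using hh
  filter_upwards [h2.eventually h1, self_mem_nhdsWithin] with h hh hpos y
  have hpos : 0 < h := hpos
  have h3 := hh y
  rw [dist_comm, dist_eq_norm, Real.coe_toNNReal h hpos.le, ← hT] at h3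
  have h4 : (∫ w, f w ∂(κ h.toNNReal y)) - (f + (h : ℂ) • T f) y =
      (h : ℂ) * ((h : ℂ)⁻¹ * ((∫ w, f w ∂(κ h.toNNReal y)) - f y) - T f y) := by
    have : (h : ℂ) ≠ 0 := by exact_mod_cast hpos.ne'
    simp only [BoundedContinuousFunction.coe_add, BoundedContinuousFunction.coe_smul, Pi.add_apply,
      smul_eq_mul]
    field_simp
    ring
  rw [h4, norm_mul, Complex.norm_real, Real.norm_of_nonneg hpos.le, mul_comm]
  gcongr

namespace IsTransitionSemigroup

variable {E : Type*} [TopologicalSpace E] [MeasurableSpace E] [OpensMeasurableSpace E]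
  {κ : ℝ≥0 → Kernel E E}

theorem integrable_boundedContinuousFunction (hκ : IsTransitionSemigroup κ) (t : ℝ≥0) (x : E)
    (f : E →ᵇ ℂ) : Integrable f (κ t x) := by
  have := hκ.markov t
  exact f.integrable _

theorem integral_zero (hκ : IsTransitionSemigroup κ) (x : E) (f : E →ᵇ ℂ) :
    ∫ y, f y ∂(κ 0 x) = f x := by
  rw [hκ.zero, Kernel.id_apply, integral_dirac' _ _ f.continuous.stronglyMeasurable]

theorem integral_add (hκ : IsTransitionSemigroup κ) (s t : ℝ≥0) (x : E) (f : E →ᵇ ℂ) :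
    ∫ y, f y ∂(κ (s + t) x) = ∫ y, ∫ w, f w ∂(κ t y) ∂(κ s x) := by
  have h := hκ.integrable_boundedContinuousFunction (s + t) x f
  rw [hκ.add] at h ⊢
  exact Kernel.integral_comp h

/-- Chapman–Kolmogorov turns a uniform bound on `κ_h f - g` into a bound on `κ_{s+h} f - κ_s g`. -/
theorem norm_integral_add_sub_le (hκ : IsTransitionSemigroup κ) (s h : ℝ≥0) (x : E)
    (f g : E →ᵇ ℂ) {ε : ℝ} (hε : ∀ y, ‖(∫ w, f w ∂(κ h y)) - g y‖ ≤ ε) :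
    ‖(∫ y, f y ∂(κ (s + h) x)) - ∫ y, g y ∂(κ s x)‖ ≤ ε := by
  have := hκ.markov s
  have := hκ.markov h
  have h1 : Integrable (fun y => ∫ w, f w ∂(κ h y)) (κ s x) := by
    have h2 := hκ.integrable_boundedContinuousFunction (s + h) x f
    rw [hκ.add] at h2
    exact h2.integral_comp
  rw [hκ.integral_add, ← integral_sub h1 (g.integrable _)]
  refine (norm_integral_le_of_norm_le_const (ae_of_all _ hε)).trans ?_
  simp

theorem norm_integral_sub_integral_le (hκ : IsTransitionSemigroup κ) (t : ℝ≥0) (x : E)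
    (f g : E →ᵇ ℂ) : ‖(∫ y, f y ∂(κ t x)) - ∫ y, g y ∂(κ t x)‖ ≤ ‖f - g‖ := by
  have := hκ.markov t
  rw [← integral_sub (f.integrable _) (g.integrable _)]
  refine (norm_integral_le_of_norm_le_const (ae_of_all _ fun y => (f - g).norm_coe_le_norm y)).trans
    ?_
  simp

/-- A transition semigroup whose generator is a bounded operator `T` on bounded continuous
functions is given there by the exponential series: `κ_t = exp (t T)`. -/
theorem integral_eq_exp (hκ : IsTransitionSemigroup κ) {L : C(E, ℂ) → C(E, ℂ)}
    (hL : HasInfinitesimalGenerator κ L) (T : (E →ᵇ ℂ) →L[ℂ] (E →ᵇ ℂ))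
    (hT : ∀ f : E →ᵇ ℂ, ∀ x, T f x = L f.toContinuousMap x) (f : E →ᵇ ℂ) (t : ℝ≥0) (x : E) :
    ∫ y, f y ∂(κ t x) = NormedSpace.exp ((t : ℂ) • T) f x := by
  set g : ℝ → (E →ᵇ ℂ) := fun s => NormedSpace.exp ((s : ℂ) • T) f with hg
  have hgd : ∀ s : ℝ, HasDerivAt g (T (g s)) s := fun s => by
    have h1 : HasDerivAt (fun u : ℂ => NormedSpace.exp (u • T))
        (T * NormedSpace.exp ((s : ℂ) • T)) (s : ℂ) := hasDerivAt_exp_smul_const' T (s : ℂ)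
    have h2 := h1.clm_apply (hasDerivAt_const (s : ℂ) f)
    simpa [Function.comp_def] using h2.scomp s Complex.ofRealCLM.hasDerivAt
  have hgc : Continuous g := continuous_iff_continuousAt.2 fun s => (hgd s).continuousAt
  -- `F` interpolates between `κ_t f` at `0` and `exp (t T) f` at `t`; it is shown to be constant
  set F : ℝ → ℂ := fun s => ∫ y, g s y ∂(κ (t - s).toNNReal x) with hF
  -- `κ_{t-s} g_s - κ_{t-s-h} g_{s+h} = κ_{t-s-h} (κ_h g_s - g_{s+h})`
  have key : ∀ s u : ℝ, 0 ≤ s → s ≤ u → u ≤ t → ∀ ε : ℝ,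
      (∀ y, ‖(∫ w, g s w ∂(κ (u - s).toNNReal y)) - g u y‖ ≤ ε) → ‖F s - F u‖ ≤ ε := by
    intro s u hs hsu hut ε h
    have h1 := hκ.norm_integral_add_sub_le (t - u).toNNReal (u - s).toNNReal x (g s) (g u) h
    rwa [← Real.toNNReal_add (by linarith) (by linarith),
      show (t : ℝ) - u + (u - s) = t - s by ring] at h1
  have hright : ∀ s ∈ Set.Ico (0 : ℝ) t, HasDerivWithinAt F 0 (Set.Ici s) s := by
    intro s hs
    rw [hasDerivWithinAt_iff_isLittleO, Asymptotics.isLittleO_iff]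
    intro ε hε
    have h1 := hL.eventually_norm_integral_sub_le T hT (g s) (half_pos hε)
    have h2 : ∀ᶠ u in 𝓝[>] s, ‖g u - g s - ((u - s : ℝ) : ℂ) • T (g s)‖ ≤ ε / 2 * (u - s) := by
      have h3 := (hasDerivAt_iff_isLittleO.1 (hgd s)).def (half_pos hε)
      filter_upwards [h3.filter_mono nhdsWithin_le_nhds, self_mem_nhdsWithin] with u hu hsu
      rw [Real.norm_of_nonneg (sub_nonneg.2 (le_of_lt hsu))] at hu
      rwa [Complex.coe_smul]
    have h4 : Tendsto (fun u => u - s) (𝓝[>] s) (𝓝[>] 0) := by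
      refine tendsto_nhdsWithin_iff.2 ⟨?_, ?_⟩
      · have : Continuous fun u : ℝ => u - s := by fun_prop
        simpa using (this.tendsto s).mono_left (nhdsWithin_le_nhds (s := Set.Ioi s))
      · filter_upwards [self_mem_nhdsWithin] with u hu
        simpa using hu
    have h5 : ∀ᶠ u in 𝓝[>] s, u < (t : ℝ) := nhdsWithin_le_nhds (eventually_lt_nhds hs.2)
    rw [← Set.Ioi_insert, nhdsWithin_insert, eventually_sup]
    refine ⟨by simp, ?_⟩
    filter_upwards [h4.eventually h1, h2, h5, self_mem_nhdsWithin] with u hu1 hu2 hu3 hu4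
    have hu4 : s < u := hu4
    rw [smul_zero, sub_zero, norm_sub_rev, Real.norm_of_nonneg (by linarith)]
    refine key s u hs.1 hu4.le hu3.le _ fun y => ?_
    have h6 := hu1 y
    have h7 := ((g u - g s - ((u - s : ℝ) : ℂ) • T (g s)).norm_coe_le_norm y).trans hu2
    calc _ = ‖((∫ w, g s w ∂(κ (u - s).toNNReal y)) - (g s + ((u - s : ℝ) : ℂ) • T (g s)) y) -
          (g u - g s - ((u - s : ℝ) : ℂ) • T (g s)) y‖ := by
            congr 1
            simp only [BoundedContinuousFunction.coe_add, BoundedContinuousFunction.coe_smul,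
              BoundedContinuousFunction.coe_sub, Pi.add_apply, Pi.sub_apply]
            ring
      _ ≤ _ := norm_sub_le _ _
      _ ≤ ε * (u - s) := by linarith
  have hleft : ∀ s ∈ Set.Ioc (0 : ℝ) t, ContinuousWithinAt F (Set.Iio s) s := by
    intro s hs
    rw [ContinuousWithinAt, Metric.tendsto_nhds]
    intro ε hε
    have h1 := hL.eventually_norm_integral_sub_le T hT (g s) one_pos
    have h4 : Tendsto (fun u => s - u) (𝓝[<] s) (𝓝[>] 0) := by
      refine tendsto_nhdsWithin_iff.2 ⟨?_, ?_⟩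
      · have : Continuous fun u : ℝ => s - u := by fun_prop
        simpa using (this.tendsto s).mono_left (nhdsWithin_le_nhds (s := Set.Iio s))
      · filter_upwards [self_mem_nhdsWithin] with u hu
        simpa using hu
    have h2 : Tendsto (fun u => ‖g u - g s‖ + (s - u) * (‖T (g s)‖ + 1)) (𝓝[<] s) (𝓝 0) := by
      have : Continuous fun u => ‖g u - g s‖ + (s - u) * (‖T (g s)‖ + 1) := by fun_prop
      simpa using (this.tendsto s).mono_left (nhdsWithin_le_nhds (s := Set.Iio s))
    have h5 : ∀ᶠ u in 𝓝[<] s, 0 < u := nhdsWithin_le_nhds (eventually_gt_nhds hs.1)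
    filter_upwards [h4.eventually h1, h2.eventually (eventually_lt_nhds hε), h5,
      self_mem_nhdsWithin] with u hu1 hu2 hu3 hu4
    have hu4 : u < s := hu4
    rw [dist_eq_norm]
    refine (key u s hu3.le hu4.le hs.2 _ fun y => ?_).trans_lt hu2
    have h6 := hu1 y
    have h7 := hκ.norm_integral_sub_integral_le (s - u).toNNReal y (g u) (g s)
    have h8 : ‖((s - u : ℝ) : ℂ) • T (g s) y‖ ≤ (s - u) * ‖T (g s)‖ := by
      rw [norm_smul, Complex.norm_real, Real.norm_of_nonneg (by linarith)]
      exact mul_le_mul_of_nonneg_left ((T (g s)).norm_coe_le_norm y) (by linarith)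
    calc _ = ‖((∫ w, g u w ∂(κ (s - u).toNNReal y)) - ∫ w, g s w ∂(κ (s - u).toNNReal y)) +
          (((∫ w, g s w ∂(κ (s - u).toNNReal y)) - (g s + ((s - u : ℝ) : ℂ) • T (g s)) y) +
          ((s - u : ℝ) : ℂ) • T (g s) y)‖ := by
            congr 1
            simp only [BoundedContinuousFunction.coe_add, BoundedContinuousFunction.coe_smul,
              Pi.add_apply]
            ring
      _ ≤ _ := (norm_add_le _ _).trans (add_le_add le_rfl (norm_add_le _ _))
      _ ≤ _ := by linarith
  have hcont : ContinuousOn F (Set.Icc 0 t) := by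
    intro s hs
    have hr : s < t → ContinuousWithinAt F (Set.Ici s) s := fun h =>
      (hright s ⟨hs.1, h⟩).continuousWithinAt
    rcases hs.1.eq_or_lt with h0 | h0
    · rcases hs.2.eq_or_lt with h1 | h1
      · rw [← h1, ← h0, Set.Icc_self]
        exact continuousWithinAt_singleton
      · exact (hr h1).mono fun u hu => by simpa [← h0] using hu.1
    · have hl := (hleft s ⟨h0, hs.2⟩).insert
      rcases hs.2.eq_or_lt with h1 | h1
      · refine hl.mono fun u hu => ?_
        rw [Set.Iio_insert]
        exact hu.2.trans h1.ge
      · refine (hl.union (hr h1)).mono fun u _ => ?_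
        rw [Set.Iio_insert]
        exact le_total u s
  have hfin := constant_of_has_deriv_right_zero hcont hright t ⟨t.2, le_rfl⟩
  have h0 : F 0 = ∫ y, f y ∂(κ t x) := by
    have h1 : g 0 = f := by
      have h2 : ((0 : ℝ) : ℂ) • T = 0 := by
        ext f y
        simp
      simp only [hg, h2, NormedSpace.exp_zero]
      rfl
    simp [hF, h1]
  have ht : F t = NormedSpace.exp ((t : ℂ) • T) f x := by
    simp only [hF, sub_self, Real.toNNReal_zero]
    rw [hκ.integral_zero]
  rw [← h0, ← hfin, ht]

end IsTransitionSemigroup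

/-! ### The jump generator on functions of linear growth -/

theorem jumpGenerator_apply {d : ℕ} (A : Matrix (Fin d) (Fin d) ℂ) (f : C(JumpState d, ℂ))
    (x : JumpState d) :
    jumpGenerator A f x = ∑ j ∈ Finset.univ.erase x.2, (f (x.1 * A x.2 j, j) - f x) := rfl

theorem norm_jumpGenerator_le_norm {d : ℕ} (A : Matrix (Fin d) (Fin d) ℂ) (f : JumpState d →ᵇ ℂ)
    (x : JumpState d) : ‖jumpGenerator A f.toContinuousMap x‖ ≤ 2 * d * ‖f‖ := by
  rw [jumpGenerator_apply]
  refine (norm_sum_le_of_le (n := fun _ => 2 * ‖f‖) _ fun j _ => ?_).trans ?_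
  · calc _ ≤ ‖f (x.1 * A x.2 j, j)‖ + ‖f x‖ := norm_sub_le _ _
      _ ≤ 2 * ‖f‖ := by
        linarith [f.norm_coe_le_norm (x.1 * A x.2 j, j), f.norm_coe_le_norm x]
  · rw [Finset.sum_const, nsmul_eq_mul]
    have : ((Finset.univ.erase x.2).card : ℝ) ≤ d := by
      exact_mod_cast (Finset.card_le_univ _).trans_eq (Fintype.card_fin d)
    nlinarith [norm_nonneg f]

/-- The operator `𝒜`, as a bounded operator on the bounded continuous functions. -/
noncomputable def jumpGeneratorCLM {d : ℕ} (A : Matrix (Fin d) (Fin d) ℂ) :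
    (JumpState d →ᵇ ℂ) →L[ℂ] (JumpState d →ᵇ ℂ) :=
  LinearMap.mkContinuous
    { toFun := fun f => BoundedContinuousFunction.ofNormedAddCommGroup
        (jumpGenerator A f.toContinuousMap) (jumpGenerator A f.toContinuousMap).continuous
        (2 * d * ‖f‖) (norm_jumpGenerator_le_norm A f)
      map_add' := fun f g => by
        ext x
        simp only [jumpGenerator, BoundedContinuousFunction.coe_ofNormedAddCommGroup,
          ContinuousMap.coe_mk, BoundedContinuousFunction.coe_add, Pi.add_apply,
          BoundedContinuousFunction.coe_toContinuousMap, ← Finset.sum_add_distrib]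
        exact Finset.sum_congr rfl fun j _ => by ring
      map_smul' := fun c f => by
        ext x
        simp only [jumpGenerator, BoundedContinuousFunction.coe_ofNormedAddCommGroup,
          ContinuousMap.coe_mk, BoundedContinuousFunction.coe_smul, RingHom.id_apply,
          BoundedContinuousFunction.coe_toContinuousMap, smul_eq_mul, Finset.mul_sum, mul_sub] }
    (2 * d) fun f => BoundedContinuousFunction.norm_ofNormedAddCommGroup_le _ (by positivity)
      (norm_jumpGenerator_le_norm A f)

theorem jumpGeneratorCLM_apply {d : ℕ} (A : Matrix (Fin d) (Fin d) ℂ) (f : JumpState d →ᵇ ℂ)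
    (x : JumpState d) : jumpGeneratorCLM A f x = jumpGenerator A f.toContinuousMap x := rfl

theorem jumpGeneratorCLM_pow_toContinuousMap {d : ℕ} (A : Matrix (Fin d) (Fin d) ℂ)
    (f : JumpState d →ᵇ ℂ) (k : ℕ) : ((jumpGeneratorCLM A ^ k) f).toContinuousMap =
      (jumpGenerator A)^[k] f.toContinuousMap := by
  induction k with
  | zero => rfl
  | succ k ih =>
    rw [pow_succ', Function.iterate_succ_apply', ← ih]
    rfl

/-- A crude bound for the growth, under `𝒜`, of functions bounded by a multiple of `|ζ|`: summing
over all entries of `A` makes it independent of the row. -/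
noncomputable def jumpGrowthRate {d : ℕ} (A : Matrix (Fin d) (Fin d) ℂ) : ℝ :=
  ∑ i, ∑ j, (‖A i j‖ + 1)

/-- `𝒜` preserves the functions `f` with `|f(ζ, i)| ≤ c |ζ|`, for varying `c`. -/
theorem norm_jumpGenerator_le {d : ℕ} (A : Matrix (Fin d) (Fin d) ℂ) {f : C(JumpState d, ℂ)}
    {c : ℝ} (hf : ∀ x, ‖f x‖ ≤ c * ‖x.1‖) (x : JumpState d) :
    ‖jumpGenerator A f x‖ ≤ c * jumpGrowthRate A * ‖x.1‖ := by
  have hc : 0 ≤ c := by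
    have := (norm_nonneg _).trans (hf (1, x.2))
    simpa using this
  have h1 : ∑ j, (‖A x.2 j‖ + 1) ≤ jumpGrowthRate A :=
    Finset.single_le_sum (f := fun i => ∑ j, (‖A i j‖ + 1)) (fun i _ => by positivity)
      (Finset.mem_univ x.2)
  calc ‖jumpGenerator A f x‖ ≤ ∑ j ∈ Finset.univ.erase x.2, c * ‖x.1‖ * (‖A x.2 j‖ + 1) := by
        rw [jumpGenerator_apply]
        refine norm_sum_le_of_le _ fun j _ => ?_
        calc _ ≤ ‖f (x.1 * A x.2 j, j)‖ + ‖f x‖ := norm_sub_le _ _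
          _ ≤ c * ‖x.1 * A x.2 j‖ + c * ‖x.1‖ := add_le_add (hf _) (hf _)
          _ = _ := by rw [norm_mul]; ring
    _ ≤ ∑ j, c * ‖x.1‖ * (‖A x.2 j‖ + 1) :=
        Finset.sum_le_sum_of_subset_of_nonneg (Finset.erase_subset _ _) fun _ _ _ => by positivity
    _ ≤ c * ‖x.1‖ * jumpGrowthRate A := by
        rw [← Finset.mul_sum]
        gcongr
    _ = _ := by ring

theorem norm_iterate_jumpGenerator_le {d : ℕ} (A : Matrix (Fin d) (Fin d) ℂ)
    {f : C(JumpState d, ℂ)} {c : ℝ} (hf : ∀ x, ‖f x‖ ≤ c * ‖x.1‖) (k : ℕ) (x : JumpState d) :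
    ‖(jumpGenerator A)^[k] f x‖ ≤ c * jumpGrowthRate A ^ k * ‖x.1‖ := by
  induction k generalizing x with
  | zero => simpa using hf x
  | succ k ih =>
    rw [Function.iterate_succ_apply', pow_succ, ← mul_assoc]
    exact norm_jumpGenerator_le A ih x

theorem tendsto_iterate_jumpGenerator {d : ℕ} (A : Matrix (Fin d) (Fin d) ℂ)
    {F : ℕ → C(JumpState d, ℂ)} {f : C(JumpState d, ℂ)}
    (hF : ∀ x, Tendsto (fun n => F n x) atTop (𝓝 (f x))) (k : ℕ) (x : JumpState d) :
    Tendsto (fun n => (jumpGenerator A)^[k] (F n) x) atTop (𝓝 ((jumpGenerator A)^[k] f x)) := by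
  induction k generalizing x with
  | zero => exact hF x
  | succ k ih =>
    simp only [Function.iterate_succ_apply', jumpGenerator_apply]
    exact tendsto_finsetSum _ fun j _ => (ih _).sub (ih _)

/-- The matrix by which `𝒜` acts on the functions `f^ρ`: the off-diagonal part of `A`, minus
`d - 1` on the diagonal. -/
noncomputable def jumpMatrix {d : ℕ} (A : Matrix (Fin d) (Fin d) ℂ) : Matrix (Fin d) (Fin d) ℂ :=
  A - Matrix.diagonal A.diag - ((d : ℂ) - 1) • (1 : Matrix (Fin d) (Fin d) ℂ)

theorem jumpGenerator_linearFun {d : ℕ} (A : Matrix (Fin d) (Fin d) ℂ) (ρ : Fin d → ℂ) :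
    jumpGenerator A (linearFun ρ) = linearFun ((jumpMatrix A).mulVec ρ) := by
  ext x
  have hd : 1 ≤ d := x.2.pos
  have h1 : ∑ j, A x.2 j * ρ j = ∑ j ∈ Finset.univ.erase x.2, A x.2 j * ρ j + A x.2 x.2 * ρ x.2 :=
    (Finset.sum_erase_add _ _ (Finset.mem_univ _)).symm
  have h2 : (jumpMatrix A).mulVec ρ x.2 =
      ∑ j ∈ Finset.univ.erase x.2, A x.2 j * ρ j - ((d : ℂ) - 1) * ρ x.2 := by
    simp only [jumpMatrix, Matrix.sub_mulVec, Matrix.smul_mulVec, Matrix.one_mulVec,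
      Matrix.mulVec_diagonal, Pi.sub_apply, Pi.smul_apply, smul_eq_mul, Matrix.diag_apply]
    rw [Matrix.mulVec, dotProduct, h1]
    ring
  change ∑ j ∈ Finset.univ.erase x.2, (x.1 * A x.2 j * ρ j - x.1 * ρ x.2) =
    x.1 * (jumpMatrix A).mulVec ρ x.2
  rw [h2, Finset.sum_sub_distrib, Finset.sum_const, Finset.card_erase_of_mem (Finset.mem_univ _),
    Finset.card_univ, Fintype.card_fin, nsmul_eq_mul, Nat.cast_sub hd, mul_sub, Finset.mul_sum]
  simp only [mul_assoc, Nat.cast_one]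
  ring

theorem iterate_jumpGenerator_linearFun {d : ℕ} (A : Matrix (Fin d) (Fin d) ℂ) (ρ : Fin d → ℂ)
    (k : ℕ) : (jumpGenerator A)^[k] (linearFun ρ) = linearFun ((jumpMatrix A ^ k).mulVec ρ) := by
  induction k with
  | zero => simp
  | succ k ih =>
    rw [Function.iterate_succ_apply', ih, jumpGenerator_linearFun, Matrix.mulVec_mulVec, pow_succ']

theorem norm_linearFun_le {d : ℕ} (ρ : Fin d → ℂ) (x : JumpState d) :
    ‖linearFun ρ x‖ ≤ ‖ρ‖ * ‖x.1‖ := by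
  change ‖x.1 * ρ x.2‖ ≤ _
  rw [norm_mul, mul_comm]
  gcongr
  exact norm_le_pi_norm ρ x.2

/-- `f^{exp(tM) ρ} = ∑_k t^k / k! f^{M^k ρ}`, pointwise. -/
theorem hasSum_linearFun_exp {d : ℕ} (M : Matrix (Fin d) (Fin d) ℂ) (t : ℂ) (ρ : Fin d → ℂ)
    (x : JumpState d) :
    HasSum (fun k : ℕ => ((k.factorial : ℂ)⁻¹ * t ^ k) * linearFun ((M ^ k).mulVec ρ) x)
      (linearFun ((NormedSpace.exp (t • M)).mulVec ρ) x) := by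
  have h1 : HasSum (fun k : ℕ => ((k.factorial : ℂ)⁻¹) • (t • M) ^ k)
      (NormedSpace.exp (t • M)) := by
    open scoped Matrix.Norms.Operator in
    exact NormedSpace.exp_series_hasSum_exp' (𝕂 := ℂ) (t • M)
  let φ : Matrix (Fin d) (Fin d) ℂ →+ ℂ :=
    { toFun := fun N => x.1 * N.mulVec ρ x.2
      map_zero' := by simp
      map_add' := fun N N' => by rw [Matrix.add_mulVec, Pi.add_apply, mul_add] }
  have hφ : Continuous φ := continuous_const.mul
    ((continuous_apply x.2).comp (continuous_id.matrix_mulVec continuous_const))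
  refine (h1.map φ hφ).congr_fun fun k => ?_
  change _ = x.1 * (((k.factorial : ℂ)⁻¹) • (t • M) ^ k).mulVec ρ x.2
  rw [smul_pow, smul_smul, Matrix.smul_mulVec]
  change _ * (x.1 * _) = x.1 * (_ * _)
  ring

theorem hasSum_exp_smul_apply {V : Type*} [NormedAddCommGroup V] [NormedSpace ℂ V]
    [CompleteSpace V] (T : V →L[ℂ] V) (t : ℂ) (v : V) :
    HasSum (fun k : ℕ => ((k.factorial : ℂ)⁻¹ * t ^ k) • (T ^ k) v)
      (NormedSpace.exp (t • T) v) := by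
  refine ((ContinuousLinearMap.apply ℂ V v).hasSum
    (NormedSpace.exp_series_hasSum_exp' (𝕂 := ℂ) (t • T))).congr_fun fun k => ?_
  simp [smul_pow, smul_smul]

/-- The semigroup generated by `𝒜` on bounded continuous functions, as a power series in `t`. -/
theorem IsTransitionSemigroup.hasSum_integral {d : ℕ} {A : Matrix (Fin d) (Fin d) ℂ}
    {κ : ℝ≥0 → Kernel (JumpState d) (JumpState d)} (hκ : IsTransitionSemigroup κ)
    (hL : HasInfinitesimalGenerator κ (jumpGenerator A)) (f : JumpState d →ᵇ ℂ) (t : ℝ≥0)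
    (x : JumpState d) :
    HasSum (fun k : ℕ => ((k.factorial : ℂ)⁻¹ * (t : ℂ) ^ k) *
      (jumpGenerator A)^[k] f.toContinuousMap x) (∫ y, f y ∂(κ t x)) := by
  rw [hκ.integral_eq_exp hL (jumpGeneratorCLM A) (jumpGeneratorCLM_apply A)]
  refine ((BoundedContinuousFunction.evalCLM ℂ x).hasSum
    (hasSum_exp_smul_apply (jumpGeneratorCLM A) t f)).congr_fun fun k => ?_
  rw [← jumpGeneratorCLM_pow_toContinuousMap, map_smul]
  rfl

theorem norm_exp_coeff_mul_le {t c K z : ℝ} (ht : 0 ≤ t) {a : ℂ} {k : ℕ}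
    (ha : ‖a‖ ≤ c * K ^ k * z) :
    ‖((k.factorial : ℂ)⁻¹ * (t : ℂ) ^ k) * a‖ ≤ c * z * ((t * K) ^ k / k.factorial) := by
  rw [norm_mul, norm_mul, norm_inv, norm_pow, Complex.norm_natCast, Complex.norm_real,
    Real.norm_of_nonneg ht]
  calc _ ≤ (k.factorial : ℝ)⁻¹ * t ^ k * (c * K ^ k * z) := by gcongr
    _ = _ := by rw [mul_pow]; ring

theorem hasSum_pow_div_factorial (c x : ℝ) :
    HasSum (fun k : ℕ => c * (x ^ k / k.factorial)) (c * Real.exp x) := by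
  rw [Real.exp_eq_exp_ℝ]
  exact (NormedSpace.expSeries_div_hasSum_exp x).mul_left c

/-- The semigroup preserves the bound `|f(ζ, i)| ≤ c |ζ|` up to a factor exponential in time. -/
theorem IsTransitionSemigroup.norm_integral_le {d : ℕ} {A : Matrix (Fin d) (Fin d) ℂ}
    {κ : ℝ≥0 → Kernel (JumpState d) (JumpState d)} (hκ : IsTransitionSemigroup κ)
    (hL : HasInfinitesimalGenerator κ (jumpGenerator A)) {f : JumpState d →ᵇ ℂ} {c : ℝ}
    (hf : ∀ x, ‖f x‖ ≤ c * ‖x.1‖) (t : ℝ≥0) (x : JumpState d) :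
    ‖∫ y, f y ∂(κ t x)‖ ≤ c * ‖x.1‖ * Real.exp (t * jumpGrowthRate A) := by
  rw [← (hκ.hasSum_integral hL f t x).tsum_eq]
  exact tsum_of_norm_bounded (hasSum_pow_div_factorial _ _) fun k =>
    norm_exp_coeff_mul_le t.2 (norm_iterate_jumpGenerator_le A hf k x)

/-- The linear functions `f^ρ` are unbounded, but dominated convergence in the power series
extends to them the action of the semigroup, as the matrix exponential of `jumpMatrix A`. -/
theorem IsTransitionSemigroup.tendsto_integral_linearFun {d : ℕ}
    {A : Matrix (Fin d) (Fin d) ℂ}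
    {κ : ℝ≥0 → Kernel (JumpState d) (JumpState d)} (hκ : IsTransitionSemigroup κ)
    (hL : HasInfinitesimalGenerator κ (jumpGenerator A)) {F : ℕ → (JumpState d →ᵇ ℂ)} {c : ℝ}
    (hF : ∀ n x, ‖F n x‖ ≤ c * ‖x.1‖) {ρ : Fin d → ℂ}
    (hFρ : ∀ x, Tendsto (fun n => F n x) atTop (𝓝 (linearFun ρ x))) (t : ℝ≥0) (x : JumpState d) :
    Tendsto (fun n => ∫ y, F n y ∂(κ t x)) atTop
      (𝓝 (linearFun ((NormedSpace.exp ((t : ℂ) • jumpMatrix A)).mulVec ρ) x)) := by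
  rw [← (hasSum_linearFun_exp (jumpMatrix A) t ρ x).tsum_eq]
  simp_rw [← fun n => (hκ.hasSum_integral hL (F n) t x).tsum_eq]
  refine tendsto_tsum_of_dominated_convergence
    (hasSum_pow_div_factorial (c * ‖x.1‖) (t * jumpGrowthRate A)).summable (fun k => ?_)
    (Eventually.of_forall fun n k =>
      norm_exp_coeff_mul_le t.2 (norm_iterate_jumpGenerator_le A (hF n) k x))
  rw [← iterate_jumpGenerator_linearFun]
  exact (tendsto_iterate_jumpGenerator A hFρ k x).const_mul _

/-- The factor `1 / (1 + |ζ| / (n + 1))`, which makes functions of linear growth bounded. -/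
noncomputable def linearCutoff {d : ℕ} (n : ℕ) (x : JumpState d) : ℝ := (1 + ‖x.1‖ / (n + 1))⁻¹

theorem linearCutoff_nonneg {d : ℕ} (n : ℕ) (x : JumpState d) : 0 ≤ linearCutoff n x := by
  unfold linearCutoff
  positivity

theorem linearCutoff_le_one {d : ℕ} (n : ℕ) (x : JumpState d) : linearCutoff n x ≤ 1 :=
  inv_le_one_of_one_le₀ (le_add_of_nonneg_right (by positivity))

theorem linearCutoff_mul_norm_le {d : ℕ} (n : ℕ) (x : JumpState d) :
    linearCutoff n x * ‖x.1‖ ≤ n + 1 := by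
  unfold linearCutoff
  rw [inv_mul_le_iff₀ (by positivity), add_mul, div_mul_cancel₀ _ (by positivity)]
  linarith [(by positivity : (0 : ℝ) ≤ n + 1)]

theorem continuous_linearCutoff {d : ℕ} (n : ℕ) :
    Continuous (linearCutoff n : JumpState d → ℝ) := by
  unfold linearCutoff
  exact Continuous.inv₀ (by fun_prop) fun x => by positivity

theorem tendsto_linearCutoff {d : ℕ} (x : JumpState d) :
    Tendsto (fun n => linearCutoff n x) atTop (𝓝 1) := by
  have h1 : Tendsto (fun n : ℕ => ‖x.1‖ / ((n : ℝ) + 1)) atTop (𝓝 0) :=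
    tendsto_const_nhds.div_atTop (tendsto_atTop_add_const_right _ _ tendsto_natCast_atTop_atTop)
  have h2 := ((h1.const_add 1).inv₀ (by simp))
  simpa [linearCutoff] using h2

/-- The truncation of a function bounded by a multiple of `|ζ|`. -/
noncomputable def truncated {d : ℕ} (f : C(JumpState d, ℂ)) {c : ℝ}
    (hf : ∀ x, ‖f x‖ ≤ c * ‖x.1‖) (n : ℕ) : JumpState d →ᵇ ℂ :=
  BoundedContinuousFunction.ofNormedAddCommGroup (fun x => (linearCutoff n x : ℂ) * f x)
    ((Complex.continuous_ofReal.comp (continuous_linearCutoff n)).mul f.continuous) (c * (n + 1))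
    fun x => by
      have hc : 0 ≤ c := by simpa using (norm_nonneg _).trans (hf (1, x.2))
      rw [norm_mul, Complex.norm_real, Real.norm_of_nonneg (linearCutoff_nonneg n x)]
      calc _ ≤ linearCutoff n x * (c * ‖x.1‖) :=
            mul_le_mul_of_nonneg_left (hf x) (linearCutoff_nonneg n x)
        _ = c * (linearCutoff n x * ‖x.1‖) := by ring
        _ ≤ _ := mul_le_mul_of_nonneg_left (linearCutoff_mul_norm_le n x) hc

theorem truncated_apply {d : ℕ} (f : C(JumpState d, ℂ)) {c : ℝ}
    (hf : ∀ x, ‖f x‖ ≤ c * ‖x.1‖) (n : ℕ) (x : JumpState d) :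
    truncated f hf n x = (linearCutoff n x : ℂ) * f x := rfl

theorem norm_truncated_le_norm {d : ℕ} (f : C(JumpState d, ℂ)) {c : ℝ}
    (hf : ∀ x, ‖f x‖ ≤ c * ‖x.1‖) (n : ℕ) (x : JumpState d) : ‖truncated f hf n x‖ ≤ ‖f x‖ := by
  rw [truncated_apply, norm_mul, Complex.norm_real, Real.norm_of_nonneg (linearCutoff_nonneg n x)]
  exact mul_le_of_le_one_left (norm_nonneg _) (linearCutoff_le_one n x)

theorem tendsto_truncated {d : ℕ} (f : C(JumpState d, ℂ)) {c : ℝ}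
    (hf : ∀ x, ‖f x‖ ≤ c * ‖x.1‖) (x : JumpState d) :
    Tendsto (fun n => truncated f hf n x) atTop (𝓝 (f x)) := by
  have h := ((Complex.continuous_ofReal.tendsto 1).comp (tendsto_linearCutoff x)).mul_const (f x)
  simpa [truncated_apply, Function.comp_def] using h

/-! ### The Markov property for linear functions -/

theorem IsMarkovProcessWithGenerator.measurable {E : Type*} [TopologicalSpace E]
    [MeasurableSpace E] {L : C(E, ℂ) → C(E, ℂ)} {x : E} {Ω : Type*} {m : MeasurableSpace Ω}
    {P : Measure Ω} {ℱ : Filtration ℝ≥0 m} {Y : ℝ≥0 → Ω → E}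
    (hY : IsMarkovProcessWithGenerator L x P ℱ Y) (t : ℝ≥0) : Measurable (Y t) :=
  (hY.adapted t).mono (ℱ.le t) le_rfl

/-- The Markov property in weak form, tested against a bounded `ℱ_s`-measurable weight. -/
theorem integral_mul_of_condExp_eq {E : Type*} [TopologicalSpace E] [MeasurableSpace E]
    [OpensMeasurableSpace E] {Ω : Type*} {m' m : MeasurableSpace Ω} (hm : m' ≤ m) {P : Measure Ω}
    [IsProbabilityMeasure P] {X : Ω → E} (hX : Measurable X) (f : E →ᵇ ℂ) {k : Ω → ℂ}
    (hk : P[fun ω => f (X ω) | m'] =ᵐ[P] k) {g : Ω → ℂ} (hg : StronglyMeasurable[m'] g) {C : ℝ}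
    (hC : ∀ ω, ‖g ω‖ ≤ C) : ∫ ω, g ω * f (X ω) ∂P = ∫ ω, g ω * k ω ∂P := by
  have hf : Integrable (fun ω => f (X ω)) P :=
    Integrable.of_bound (f.continuous.measurable.comp hX).aestronglyMeasurable ‖f‖
      (ae_of_all _ fun ω => f.norm_coe_le_norm _)
  have h1 := condExp_stronglyMeasurable_bilin_of_bound (ContinuousLinearMap.mul ℝ ℂ) hm hg hf C
    (ae_of_all _ hC)
  simp only [ContinuousLinearMap.mul_apply'] at h1
  rw [← integral_condExp hm]
  refine integral_congr_ae ?_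
  filter_upwards [h1, hk] with ω h2 h3
  rw [h2, h3]

section

variable {d : ℕ} {A : Matrix (Fin d) (Fin d) ℂ} {x : JumpState d} {Ω : Type*}
  {m : MeasurableSpace Ω} {P : Measure Ω} {ℱ : Filtration ℝ≥0 m} {Y : ℝ≥0 → Ω → JumpState d}

/-- The first moment of `Z_t` is finite: it is the limit of truncated moments, which the semigroup
bounds. -/
theorem IsMarkovProcessWithGenerator.integrable_fst
    (hY : IsMarkovProcessWithGenerator (jumpGenerator A) x P ℱ Y) (t : ℝ≥0) :
    Integrable (fun ω => (Y t ω).1) P := by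
  have := hY.isProbabilityMeasure
  obtain ⟨κ, hκ, hL, hM⟩ := hY.markov
  have hmeas := (measurable_fst.comp (hY.measurable t)).aestronglyMeasurable (μ := P)
  let f : C(JumpState d, ℂ) := ⟨fun x => (‖x.1‖ : ℂ), by fun_prop⟩
  have hf : ∀ x, ‖f x‖ ≤ 1 * ‖x.1‖ := fun x => by simp [f]
  set K := ‖x.1‖ * Real.exp (t * jumpGrowthRate A)
  have hbound : ∀ n, ∫⁻ ω, ENNReal.ofReal (linearCutoff n (Y t ω) * ‖(Y t ω).1‖) ∂P
      ≤ ENNReal.ofReal K := by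
    intro n
    have h1 := hM 0 t (truncated f hf n)
    rw [zero_add] at h1
    have h2 := integral_mul_of_condExp_eq (ℱ.le 0) (hY.measurable t) _ h1
      (stronglyMeasurable_const (b := (1 : ℂ))) (C := 1) (by simp)
    simp only [one_mul] at h2
    have h3 : ∫ ω, (∫ y, truncated f hf n y ∂(κ t (Y 0 ω))) ∂P =
        ∫ y, truncated f hf n y ∂(κ t x) := by
      rw [integral_congr_ae (g := fun _ => ∫ y, truncated f hf n y ∂(κ t x))]
      · simp
      · filter_upwards [hY.initial] with ω hω
        rw [hω]
    have h4 := hκ.norm_integral_le hL (f := truncated f hf n) (c := 1)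
      (fun x => (norm_truncated_le_norm f hf n x).trans (hf x)) t x
    rw [← h3, ← h2, one_mul] at h4
    have h5 : ∫ ω, truncated f hf n (Y t ω) ∂P =
        ((∫ ω, linearCutoff n (Y t ω) * ‖(Y t ω).1‖ ∂P : ℝ) : ℂ) := by
      rw [← integral_complex_ofReal]
      refine integral_congr_ae (ae_of_all _ fun ω => ?_)
      simp [truncated_apply, f]
    have h6 : ∀ ω, 0 ≤ linearCutoff n (Y t ω) * ‖(Y t ω).1‖ := fun ω =>
      mul_nonneg (linearCutoff_nonneg _ _) (norm_nonneg _)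
    have h7 : Integrable (fun ω => linearCutoff n (Y t ω) * ‖(Y t ω).1‖) P := by
      refine Integrable.of_bound (((continuous_linearCutoff n).measurable.comp
        (hY.measurable t)).aestronglyMeasurable.mul hmeas.norm) (n + 1) (ae_of_all _ fun ω => ?_)
      rw [Real.norm_of_nonneg (h6 ω)]
      exact linearCutoff_mul_norm_le n _
    rw [← ofReal_integral_eq_lintegral_ofReal h7 (ae_of_all _ h6)]
    refine ENNReal.ofReal_le_ofReal (le_trans (le_abs_self _) ?_)
    rwa [h5, Complex.norm_real] at h4
  refine ⟨hmeas, ?_⟩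
  have hlim : ∀ ω, Tendsto
      (fun n => ENNReal.ofReal (linearCutoff n (Y t ω) * ‖(Y t ω).1‖)) atTop
      (𝓝 ‖(Y t ω).1‖ₑ) := fun ω => by
    rw [← ofReal_norm]
    refine ENNReal.tendsto_ofReal ?_
    simpa using (tendsto_linearCutoff (Y t ω)).mul_const ‖(Y t ω).1‖
  calc ∫⁻ ω, ‖(Y t ω).1‖ₑ ∂P
      = ∫⁻ ω, liminf (fun n => ENNReal.ofReal (linearCutoff n (Y t ω) * ‖(Y t ω).1‖)) atTop ∂P :=
        lintegral_congr fun ω => (hlim ω).liminf_eq.symm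
    _ ≤ liminf (fun n => ∫⁻ ω, ENNReal.ofReal (linearCutoff n (Y t ω) * ‖(Y t ω).1‖) ∂P) atTop :=
        lintegral_liminf_le fun n => ((((continuous_linearCutoff n).measurable.comp
          (hY.measurable t)).mul (measurable_fst.comp (hY.measurable t)).norm)).ennreal_ofReal
    _ ≤ ENNReal.ofReal K := by
        refine (liminf_le_liminf (Eventually.of_forall hbound)).trans ?_
        simp
    _ < ⊤ := ENNReal.ofReal_lt_top

theorem IsMarkovProcessWithGenerator.integrable_mul_linearFun
    (hY : IsMarkovProcessWithGenerator (jumpGenerator A) x P ℱ Y) (t : ℝ≥0) {g : Ω → ℂ}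
    (hg : AEStronglyMeasurable g P) {C : ℝ} (hC : ∀ᵐ ω ∂P, ‖g ω‖ ≤ C) (ρ : Fin d → ℂ) :
    Integrable (fun ω => g ω * linearFun ρ (Y t ω)) P := by
  have h1 : Integrable (fun ω => linearFun ρ (Y t ω)) P :=
    ((hY.integrable_fst t).norm.const_mul ‖ρ‖).mono'
      ((linearFun ρ).continuous.measurable.comp (hY.measurable t)).aestronglyMeasurable
      (ae_of_all _ fun ω => norm_linearFun_le ρ _)
  exact h1.bdd_mul hg hC

/-- The Markov property for the linear functions `f^ρ`, on which the semigroup acts by the matrix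
exponential of `jumpMatrix A`. -/
theorem IsMarkovProcessWithGenerator.integral_mul_linearFun
    (hY : IsMarkovProcessWithGenerator (jumpGenerator A) x P ℱ Y) (s t : ℝ≥0) {g : Ω → ℂ}
    (hg : StronglyMeasurable[ℱ s] g) {C : ℝ} (hC : ∀ ω, ‖g ω‖ ≤ C) (ρ : Fin d → ℂ) :
    ∫ ω, g ω * linearFun ρ (Y (s + t) ω) ∂P =
      ∫ ω, g ω * linearFun ((NormedSpace.exp ((t : ℂ) • jumpMatrix A)).mulVec ρ) (Y s ω) ∂P := by
  have := hY.isProbabilityMeasure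
  obtain ⟨κ, hκ, hL, hM⟩ := hY.markov
  have hgm : AEStronglyMeasurable g P := (hg.mono (ℱ.le s)).aestronglyMeasurable
  set F := truncated (linearFun ρ) (norm_linearFun_le ρ)
  have hF : ∀ n y, ‖F n y‖ ≤ ‖ρ‖ * ‖y.1‖ := fun n y =>
    (norm_truncated_le_norm _ _ n y).trans (norm_linearFun_le ρ y)
  have hlim1 : Tendsto (fun n => ∫ ω, g ω * F n (Y (s + t) ω) ∂P) atTop
      (𝓝 (∫ ω, g ω * linearFun ρ (Y (s + t) ω) ∂P)) := by
    refine tendsto_integral_of_dominated_convergence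
      (fun ω => C * (‖ρ‖ * ‖(Y (s + t) ω).1‖))
      (fun n => hgm.mul ((F n).continuous.measurable.comp
        (hY.measurable (s + t))).aestronglyMeasurable)
      (((hY.integrable_fst (s + t)).norm.const_mul _).const_mul _)
      (fun n => ae_of_all _ fun ω => ?_) (ae_of_all _ fun ω => ?_)
    · rw [norm_mul]
      exact mul_le_mul (hC ω) (hF n _) (norm_nonneg _) ((norm_nonneg _).trans (hC ω))
    · exact (tendsto_truncated _ _ _).const_mul _
  have heq : ∀ n, ∫ ω, g ω * F n (Y (s + t) ω) ∂P =
      ∫ ω, g ω * ∫ y, F n y ∂(κ t (Y s ω)) ∂P := fun n =>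
    integral_mul_of_condExp_eq (ℱ.le s) (hY.measurable (s + t)) _ (hM s t (F n)) hg hC
  have hlim2 : Tendsto (fun n => ∫ ω, g ω * ∫ y, F n y ∂(κ t (Y s ω)) ∂P) atTop
      (𝓝 (∫ ω, g ω *
        linearFun ((NormedSpace.exp ((t : ℂ) • jumpMatrix A)).mulVec ρ) (Y s ω) ∂P)) := by
    refine tendsto_integral_of_dominated_convergence
      (fun ω => C * (‖ρ‖ * ‖(Y s ω).1‖ * Real.exp (t * jumpGrowthRate A))) (fun n => ?_)
      ((((hY.integrable_fst s).norm.const_mul _).mul_const _).const_mul _)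
      (fun n => ae_of_all _ fun ω => ?_) (ae_of_all _ fun ω => ?_)
    · have h1 : StronglyMeasurable fun y => ∫ w, F n w ∂(κ t y) := by
        have := hκ.markov t
        exact (F n).continuous.measurable.stronglyMeasurable.integral_kernel
      exact hgm.mul (h1.comp_measurable (hY.measurable s)).aestronglyMeasurable
    · rw [norm_mul]
      exact mul_le_mul (hC ω) (hκ.norm_integral_le hL (hF n) t _) (norm_nonneg _)
        ((norm_nonneg _).trans (hC ω))
    · exact (hκ.tendsto_integral_linearFun hL hF (tendsto_truncated _ _) t _).const_mul _
  exact tendsto_nhds_unique hlim1 (by simpa only [heq] using hlim2)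

end

/-! ### The Lie–Trotter formula and Riemann sums -/

theorem norm_pow_sub_pow_le_of_norm_le {𝔸 : Type*} [NormedRing 𝔸] [NormOneClass 𝔸] {S T : 𝔸}
    {M : ℝ} (hM : 1 ≤ M) (hS : ‖S‖ ≤ M) (hT : ‖T‖ ≤ M) (n : ℕ) :
    ‖S ^ n - T ^ n‖ ≤ n * M ^ n * ‖S - T‖ := by
  induction n with
  | zero => simp
  | succ n ih =>
    have h1 : S ^ (n + 1) - T ^ (n + 1) = S ^ n * (S - T) + (S ^ n - T ^ n) * T := by
      rw [pow_succ, pow_succ]; noncomm_ring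
    have h2 : ‖S ^ n‖ ≤ M ^ (n + 1) :=
      ((norm_pow_le S n).trans (pow_le_pow_left₀ (norm_nonneg _) hS n)).trans
        (pow_le_pow_right₀ hM n.le_succ)
    calc _ ≤ ‖S ^ n * (S - T)‖ + ‖(S ^ n - T ^ n) * T‖ := h1 ▸ norm_add_le _ _
      _ ≤ ‖S ^ n‖ * ‖S - T‖ + ‖S ^ n - T ^ n‖ * ‖T‖ :=
        add_le_add (norm_mul_le _ _) (norm_mul_le _ _)
      _ ≤ M ^ (n + 1) * ‖S - T‖ + (n * M ^ n * ‖S - T‖) * M := by gcongr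
      _ = _ := by push_cast; ring

theorem norm_normedSpace_exp_le {𝔸 : Type*} [NormedRing 𝔸] [NormOneClass 𝔸]
    [NormedAlgebra ℂ 𝔸] [CompleteSpace 𝔸] (a : 𝔸) : ‖NormedSpace.exp a‖ ≤ Real.exp ‖a‖ := by
  rw [← (NormedSpace.exp_series_hasSum_exp' (𝕂 := ℂ) a).tsum_eq, Real.exp_eq_exp_ℝ]
  refine tsum_of_norm_bounded (NormedSpace.expSeries_div_hasSum_exp ‖a‖) fun k => ?_
  rw [norm_smul, norm_inv, Complex.norm_natCast, div_eq_inv_mul]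
  gcongr
  exact norm_pow_le a k

/-- The **Lie–Trotter product formula** in a complex Banach algebra. -/
theorem tendsto_exp_mul_exp_pow {𝔸 : Type*} [NormedRing 𝔸] [NormOneClass 𝔸]
    [NormedAlgebra ℂ 𝔸] [CompleteSpace 𝔸] (a b : 𝔸) :
    Tendsto (fun n : ℕ => (NormedSpace.exp (((n : ℂ) + 1)⁻¹ • a) *
      NormedSpace.exp (((n : ℂ) + 1)⁻¹ • b)) ^ (n + 1)) atTop (𝓝 (NormedSpace.exp (a + b))) := by
  set h : ℕ → ℂ := fun n => ((n : ℂ) + 1)⁻¹ with hh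
  set S : ℂ → 𝔸 := fun u => NormedSpace.exp (u • a) * NormedSpace.exp (u • b)
  set T : ℂ → 𝔸 := fun u => NormedSpace.exp (u • (a + b))
  -- the two one-step factors agree to first order
  have hderiv : HasDerivAt (fun u => S u - T u) 0 0 := by
    have h1 := ((hasDerivAt_exp_smul_const a (0 : ℂ)).mul
      (hasDerivAt_exp_smul_const b (0 : ℂ))).sub (hasDerivAt_exp_smul_const (a + b) (0 : ℂ))
    refine h1.congr_deriv ?_
    simp
  have hh0 : Tendsto h atTop (𝓝[≠] 0) := by
    refine tendsto_nhdsWithin_iff.2 ⟨?_, Eventually.of_forall fun n => ?_⟩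
    · have := tendsto_one_div_add_atTop_nhds_zero_nat (𝕜 := ℂ)
      simpa [hh] using this
    · exact inv_ne_zero (Nat.cast_add_one_ne_zero n)
  have hslope : Tendsto (fun n : ℕ => ((n : ℝ) + 1) * ‖S (h n) - T (h n)‖) atTop (𝓝 0) := by
    have h1 := (hderiv.tendsto_slope.comp hh0).norm
    rw [norm_zero] at h1
    refine h1.congr fun n => ?_
    have h2 : S 0 - T 0 = 0 := by simp [S, T]
    have h3 : ‖(n : ℂ) + 1‖ = (n : ℝ) + 1 := by
      rw [← Nat.cast_add_one, Complex.norm_natCast, Nat.cast_add_one]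
    simp only [Function.comp_apply, slope_def_module, h2, sub_zero, norm_smul, hh, inv_inv, h3]
  set M : ℝ := ‖a‖ + ‖b‖
  have hnorm : ∀ n, ‖h n‖ = ((n : ℝ) + 1)⁻¹ := fun n => by
    rw [hh, norm_inv, ← Nat.cast_add_one, Complex.norm_natCast, Nat.cast_add_one]
  have hS : ∀ n, ‖S (h n)‖ ≤ Real.exp (M / (n + 1)) := fun n => by
    refine (norm_mul_le _ _).trans ((mul_le_mul (norm_normedSpace_exp_le _)
      (norm_normedSpace_exp_le _) (norm_nonneg _) (Real.exp_nonneg _)).trans_eq ?_)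
    rw [← Real.exp_add, norm_smul, norm_smul, hnorm]
    congr 1
    ring
  have hT : ∀ n, ‖T (h n)‖ ≤ Real.exp (M / (n + 1)) := fun n => by
    refine (norm_normedSpace_exp_le _).trans (Real.exp_le_exp.2 ?_)
    rw [norm_smul, hnorm, div_eq_inv_mul]
    gcongr
    exact norm_add_le a b
  let _ : NormedAlgebra ℚ 𝔸 := NormedAlgebra.restrictScalars ℚ ℂ 𝔸
  have hTpow : ∀ n : ℕ, T (h n) ^ (n + 1) = NormedSpace.exp (a + b) := fun n => by
    rw [← NormedSpace.exp_nsmul, ← Nat.cast_smul_eq_nsmul ℂ, smul_smul, Nat.cast_add_one,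
      mul_inv_cancel₀ (Nat.cast_add_one_ne_zero n), one_smul]
  rw [tendsto_iff_norm_sub_tendsto_zero]
  refine squeeze_zero (fun _ => norm_nonneg _) (fun n => ?_)
    (by simpa using hslope.const_mul (Real.exp M))
  have h1 := norm_pow_sub_pow_le_of_norm_le (Real.one_le_exp (by positivity)) (hS n) (hT n) (n + 1)
  rw [hTpow, ← Real.exp_nat_mul, Nat.cast_add_one, mul_div_cancel₀ _ (by positivity)] at h1
  exact h1.trans_eq (by ring)

/-- Right-endpoint Riemann sums converge for bounded right-continuous functions. -/
theorem tendsto_riemannSum_of_rightContinuous {q : ℝ → ℂ}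
    (hq : ∀ s ∈ Set.Icc (0 : ℝ) 1, ContinuousWithinAt q (Set.Ici s) s) {C : ℝ}
    (hC : ∀ s, ‖q s‖ ≤ C) :
    Tendsto (fun n : ℕ => ∑ k ∈ Finset.range (n + 1), ((n : ℂ) + 1)⁻¹ * q ((k + 1) / (n + 1)))
      atTop (𝓝 (∫ s in (0 : ℝ)..1, q s)) := by
  -- the grid point next to `s` on its right, so that right-continuity applies
  set p : ℕ → ℝ → ℝ := fun n s => (⌈s * (n + 1)⌉₊ : ℝ) / (n + 1)
  have hsum : ∀ n : ℕ, ∑ k ∈ Finset.range (n + 1), ((n : ℂ) + 1)⁻¹ * q ((k + 1) / (n + 1)) =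
      ∫ s in (0 : ℝ)..1, q (p n s) := by
    intro n
    have hn : (0 : ℝ) < n + 1 := by positivity
    have hpiece : ∀ k : ℕ, Set.EqOn (fun s => q (p n s)) (fun _ => q ((k + 1) / (n + 1)))
        (Set.uIoc ((k : ℝ) / (n + 1)) ((k + 1 : ℕ) / (n + 1))) := by
      intro k s hs
      rw [Set.uIoc_of_le (by gcongr; simp)] at hs
      have : ⌈s * (n + 1)⌉₊ = k + 1 := by
        rw [Nat.ceil_eq_iff (by simp)]
        simp only [Nat.add_sub_cancel]
        exact ⟨(div_lt_iff₀ hn).1 hs.1, (le_div_iff₀ hn).1 hs.2⟩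
      simp [p, this]
    have h1 := intervalIntegral.sum_integral_adjacent_intervals (μ := volume)
      (f := fun s => q (p n s)) (a := fun k : ℕ => (k : ℝ) / (n + 1)) (n := n + 1) fun k _ =>
        (intervalIntegrable_const (c := q ((k + 1) / (n + 1)))).congr (hpiece k).symm
    have h2 : ((n + 1 : ℕ) : ℝ) / (n + 1) = 1 := by
      rw [Nat.cast_add_one]; exact div_self hn.ne'
    rw [h2, Nat.cast_zero, zero_div] at h1
    rw [← h1]
    refine Finset.sum_congr rfl fun k _ => ?_
    rw [intervalIntegral.integral_congr_ae (ae_of_all _ (hpiece k)),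
      intervalIntegral.integral_const, ← sub_div, Nat.cast_add_one, add_sub_cancel_left, Complex.real_smul]
    push_cast
    rw [one_div]
  simp_rw [hsum]
  refine intervalIntegral.tendsto_integral_filter_of_dominated_convergence (fun _ => C)
    (Eventually.of_forall fun n => ?_) (Eventually.of_forall fun n => ae_of_all _ fun s _ => hC _)
    intervalIntegrable_const (ae_of_all _ fun s hs => ?_)
  · have h1 : Measurable fun k : ℕ => q ((k : ℝ) / (n + 1)) := measurable_from_nat
    exact (h1.comp (Nat.measurable_ceil.comp (measurable_id.mul_const _))).aestronglyMeasurable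
  · rw [Set.uIoc_of_le zero_le_one] at hs
    refine (hq s ⟨hs.1.le, hs.2⟩).tendsto.comp (tendsto_nhdsWithin_iff.2 ⟨?_, ?_⟩)
    · have h1 : Tendsto (fun n : ℕ => (n : ℝ) + 1) atTop atTop :=
        tendsto_atTop_add_const_right _ _ tendsto_natCast_atTop_atTop
      exact (tendsto_nat_ceil_mul_div_atTop hs.1.le).comp h1
    · refine Eventually.of_forall fun n => ?_
      change s ≤ (⌈s * ((n : ℝ) + 1)⌉₊ : ℝ) / (n + 1)
      rw [le_div_iff₀ (by positivity)]
      exact Nat.le_ceil _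

/-! ### The Feynman–Kac formula for linear initial data -/

theorem IsCadlagPath.continuousWithinAt_comp_snd {d : ℕ} {p : ℝ≥0 → JumpState d}
    (hp : IsCadlagPath p) (c : Fin d → ℂ) (t : ℝ≥0) (s : ℝ) :
    ContinuousWithinAt (fun s : ℝ => c (p (s * t).toNNReal).2) (Set.Ici s) s := by
  have hc : Continuous fun y : JumpState d => c y.2 :=
    (continuous_of_discreteTopology (f := c)).comp continuous_snd
  have h1 : ContinuousWithinAt (fun s : ℝ => p (s * t).toNNReal) (Set.Ici s) s := by
    refine ContinuousWithinAt.comp (g := p) (f := fun s : ℝ => (s * t).toNNReal)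
      (hp (s * t).toNNReal).1 ?_ fun u hu => ?_
    · exact (continuous_real_toNNReal.comp (continuous_id.mul continuous_const)).continuousWithinAt
    · exact Real.toNNReal_le_toNNReal (mul_le_mul_of_nonneg_right hu t.2)
  exact hc.continuousAt.comp_continuousWithinAt h1

/-- Along a càdlàg path, the additive functional `∫_0^t c(X_s) ds` is a limit of Riemann sums. -/
theorem IsCadlagPath.tendsto_riemannSum {d : ℕ} {p : ℝ≥0 → JumpState d} (hp : IsCadlagPath p)
    (c : Fin d → ℂ) (t : ℝ≥0) :
    Tendsto (fun n : ℕ => ∑ k ∈ Finset.range (n + 1),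
      ((n : ℂ) + 1)⁻¹ * t * c (p ((k + 1 : ℕ) * (t / (n + 1)))).2) atTop
      (𝓝 (∫ s in (0 : ℝ)..t, c (p s.toNNReal).2)) := by
  have h1 := (tendsto_riemannSum_of_rightContinuous
    (fun s _ => hp.continuousWithinAt_comp_snd c t s) (C := ‖c‖)
    (fun s => norm_le_pi_norm c _)).const_mul (t : ℂ)
  have h2 := intervalIntegral.smul_integral_comp_mul_right (a := 0) (b := 1)
    (fun s => c (p s.toNNReal).2) (t : ℝ)
  rw [zero_mul, one_mul, Complex.real_smul] at h2
  rw [h2] at h1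
  refine h1.congr fun n => ?_
  rw [Finset.mul_sum]
  refine Finset.sum_congr rfl fun k _ => ?_
  have h3 : (((k : ℝ) + 1) / (n + 1) * t).toNNReal = (k + 1 : ℕ) * (t / (n + 1)) := by
    apply NNReal.eq
    rw [Real.coe_toNNReal _ (by positivity)]
    push_cast
    ring
  rw [h3]
  ring

theorem norm_prod_range_le_pow {f : ℕ → ℂ} {C : ℝ} (hf : ∀ k, ‖f k‖ ≤ C) (n : ℕ) :
    ‖∏ k ∈ Finset.range n, f k‖ ≤ C ^ n := by
  rw [norm_prod]
  refine (Finset.prod_le_prod (fun _ _ => norm_nonneg _) fun k _ => hf k).trans_eq ?_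
  rw [Finset.prod_const, Finset.card_range]

theorem mul_linearFun_eq_diagonal {d : ℕ} (c ρ : Fin d → ℂ) (y : JumpState d) :
    c y.2 * linearFun ρ y = linearFun ((Matrix.diagonal c).mulVec ρ) y := by
  change c y.2 * (y.1 * ρ y.2) = y.1 * _
  rw [Matrix.mulVec_diagonal]
  ring

section

variable {d : ℕ} {A : Matrix (Fin d) (Fin d) ℂ} {x : JumpState d} {Ω : Type*}
  {m : MeasurableSpace Ω} {P : Measure Ω} {ℱ : Filtration ℝ≥0 m} {Y : ℝ≥0 → Ω → JumpState d}

theorem IsMarkovProcessWithGenerator.stronglyMeasurable_prod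
    (hY : IsMarkovProcessWithGenerator (jumpGenerator A) x P ℱ Y) (h : ℝ≥0) (c : Fin d → ℂ)
    (n : ℕ) : StronglyMeasurable[ℱ (n * h)]
      fun ω => ∏ k ∈ Finset.range n, c (Y ((k + 1 : ℕ) * h) ω).2 := by
  refine Finset.stronglyMeasurable_fun_prod _ fun k hk => ?_
  have h1 : ((k + 1 : ℕ) : ℝ≥0) * h ≤ n * h := by
    gcongr
    exact Finset.mem_range.1 hk
  have h2 : Measurable c := measurable_of_countable c
  exact ((h2.comp (measurable_snd.comp (hY.adapted _))).stronglyMeasurable).mono (ℱ.mono h1)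

/-- The Feynman–Kac functional along a time grid: each step of the Markov chain multiplies `ρ` by
the semigroup matrix, each weight by a diagonal matrix. -/
theorem IsMarkovProcessWithGenerator.integral_prod_mul_linearFun
    (hY : IsMarkovProcessWithGenerator (jumpGenerator A) x P ℱ Y) (h : ℝ≥0) (c : Fin d → ℂ)
    (n : ℕ) (ρ : Fin d → ℂ) :
    ∫ ω, (∏ k ∈ Finset.range n, c (Y ((k + 1 : ℕ) * h) ω).2) * linearFun ρ (Y (n * h) ω) ∂P =
      linearFun (((NormedSpace.exp ((h : ℂ) • jumpMatrix A) * Matrix.diagonal c) ^ n).mulVec ρ)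
        x := by
  have := hY.isProbabilityMeasure
  induction n generalizing ρ with
  | zero =>
    rw [integral_congr_ae (g := fun _ => linearFun ρ x)]
    · simp
    · filter_upwards [hY.initial] with ω hω
      simp [hω]
  | succ n ih =>
    have h1 : ∀ ω, (∏ k ∈ Finset.range (n + 1), c (Y ((k + 1 : ℕ) * h) ω).2) *
        linearFun ρ (Y ((n + 1 : ℕ) * h) ω) =
        (∏ k ∈ Finset.range n, c (Y ((k + 1 : ℕ) * h) ω).2) *
          linearFun ((Matrix.diagonal c).mulVec ρ) (Y (n * h + h) ω) := fun ω => by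
      rw [Finset.prod_range_succ, mul_assoc, mul_linearFun_eq_diagonal, Nat.cast_succ, add_one_mul]
    simp_rw [h1]
    rw [hY.integral_mul_linearFun _ _ (hY.stronglyMeasurable_prod h c n)
      (fun ω => norm_prod_range_le_pow (fun k => norm_le_pi_norm c _) n), ih,
      Matrix.mulVec_mulVec, Matrix.mulVec_mulVec, pow_succ, mul_assoc]

/-- The semigroup matrix and the potential add up to `A - zB - (d - 1)`, whose last term is
scalar. -/
theorem exp_jumpMatrix_add_diagonal (A : Matrix (Fin d) (Fin d) ℂ) (b : Fin d → ℂ) (z t : ℂ) :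
    NormedSpace.exp (t • jumpMatrix A + t • Matrix.diagonal fun i => A.diag i - z * b i) =
      Complex.exp (-t * ((d : ℂ) - 1)) •
        NormedSpace.exp (t • (A - z • Matrix.diagonal b)) := by
  have h1 : t • jumpMatrix A + t • Matrix.diagonal (fun i => A.diag i - z * b i) =
      Matrix.diagonal (fun _ => -t * ((d : ℂ) - 1)) + t • (A - z • Matrix.diagonal b) := by
    ext i j
    by_cases h : i = j
    · subst h
      simp [jumpMatrix]
      ring
    · simp [jumpMatrix, h]
  have h2 : Matrix.diagonal (fun _ : Fin d => -t * ((d : ℂ) - 1)) =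
      algebraMap ℂ (Matrix (Fin d) (Fin d) ℂ) (-t * ((d : ℂ) - 1)) := by
    rw [Matrix.algebraMap_eq_diagonal]
    rfl
  have h3 : NormedSpace.exp (fun _ : Fin d => -t * ((d : ℂ) - 1)) =
      fun _ => Complex.exp (-t * ((d : ℂ) - 1)) := by
    rw [Pi.exp_def, Complex.exp_eq_exp_ℂ]
  rw [h1, Matrix.exp_add_of_commute _ _ (h2 ▸ Algebra.commutes _ _), Matrix.exp_diagonal, h3,
    ← Matrix.smul_eq_diagonal_mul]

/-- The **Feynman–Kac formula** for linear initial data: the functional is integrable, and its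
expectation is the limit of the time-discretized expectations, which the Lie–Trotter formula
identifies. -/
theorem IsMarkovProcessWithGenerator.feynmanKac
    (hY : IsMarkovProcessWithGenerator (jumpGenerator A) x P ℱ Y) (b : Fin d → ℂ) (z : ℂ)
    (r : Fin d → ℂ) (t : ℝ≥0) :
    Integrable (feynmanKacFunctional A.diag b z r Y t) P ∧
      ∫ ω, feynmanKacFunctional A.diag b z r Y t ω ∂P =
        Complex.exp (-(t : ℝ) * ((d : ℂ) - 1)) *
          linearFun ((NormedSpace.exp (((t : ℝ) : ℂ) •
            (A - z • Matrix.diagonal b))).mulVec r) x := by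
  have := hY.isProbabilityMeasure
  set V : Fin d → ℂ := fun i => A.diag i - z * b i with hV
  set w : ℕ → ℂ := fun n => ((n : ℂ) + 1)⁻¹ * t with hw
  set G : ℕ → Ω → ℂ := fun n ω =>
    ∏ k ∈ Finset.range (n + 1), Complex.exp (w n * V (Y ((k + 1 : ℕ) * (t / (n + 1))) ω).2)
  set G' : Ω → ℂ := fun ω => Complex.exp ((∫ s in (0 : ℝ)..t, A.diag (Y s.toNNReal ω).2) -
      z * ∫ s in (0 : ℝ)..t, b (Y s.toNNReal ω).2)
  have hgrid : ∀ n : ℕ, ((n + 1 : ℕ) : ℝ≥0) * (t / (n + 1)) = t := fun n => by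
    rw [Nat.cast_add_one]
    exact mul_div_cancel₀ _ (by positivity)
  have hGmeas : ∀ n, AEStronglyMeasurable (G n) P := fun n =>
    ((hY.stronglyMeasurable_prod (t / (n + 1)) (fun i => Complex.exp (w n * V i)) (n + 1)).mono
      (ℱ.le _)).aestronglyMeasurable
  have hwn : ∀ n, ‖w n‖ = ((n : ℝ) + 1)⁻¹ * t := fun n => by
    rw [hw, norm_mul, norm_inv, ← Nat.cast_add_one, Complex.norm_natCast, Nat.cast_add_one,
      Complex.norm_real, Real.norm_of_nonneg (NNReal.coe_nonneg t)]
  have hGbound : ∀ n ω, ‖G n ω‖ ≤ Real.exp (t * ‖V‖) := fun n ω => by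
    refine (norm_prod_range_le_pow (C := Real.exp (((n : ℝ) + 1)⁻¹ * t * ‖V‖)) (fun k => ?_)
      (n + 1)).trans_eq ?_
    · refine (Complex.norm_exp_le_exp_norm _).trans (Real.exp_le_exp.2 ?_)
      rw [norm_mul, hwn]
      gcongr
      exact norm_le_pi_norm V _
    · rw [← Real.exp_nat_mul, Nat.cast_add_one, ← mul_assoc, ← mul_assoc,
        mul_inv_cancel₀ (by positivity), one_mul]
  have hGlim : ∀ᵐ ω ∂P, Tendsto (fun n => G n ω) atTop (𝓝 (G' ω)) := by
    filter_upwards [hY.cadlag] with ω hω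
    have h1 := ((hω.tendsto_riemannSum A.diag t).sub
      ((hω.tendsto_riemannSum b t).const_mul z)).cexp
    refine h1.congr fun n => ?_
    simp only [G]
    rw [← Complex.exp_sum, Finset.mul_sum, ← Finset.sum_sub_distrib]
    congr 1
    refine Finset.sum_congr rfl fun k _ => ?_
    simp only [hV, hw]
    ring
  have hG'meas : AEStronglyMeasurable G' P := aestronglyMeasurable_of_tendsto_ae _ hGmeas hGlim
  have hG'bound : ∀ᵐ ω ∂P, ‖G' ω‖ ≤ Real.exp (t * ‖V‖) := by
    filter_upwards [hGlim] with ω hω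
    exact le_of_tendsto hω.norm (Eventually.of_forall fun n => hGbound n ω)
  have hfun : feynmanKacFunctional A.diag b z r Y t = fun ω => G' ω * linearFun r (Y t ω) := by
    ext ω
    simp only [feynmanKacFunctional, Real.toNNReal_coe, G']
  have hint := hY.integrable_mul_linearFun t hG'meas hG'bound r
  rw [hfun]
  refine ⟨hint, ?_⟩
  have hlim1 : Tendsto (fun n => ∫ ω, G n ω * linearFun r (Y t ω) ∂P) atTop
      (𝓝 (∫ ω, G' ω * linearFun r (Y t ω) ∂P)) := by
    refine tendsto_integral_of_dominated_convergence
      (fun ω => Real.exp (t * ‖V‖) * (‖r‖ * ‖(Y t ω).1‖))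
      (fun n => (hY.integrable_mul_linearFun t (hGmeas n)
        (ae_of_all _ (hGbound n)) r).aestronglyMeasurable)
      (((hY.integrable_fst t).norm.const_mul _).const_mul _)
      (fun n => ae_of_all _ fun ω => ?_) ?_
    · rw [norm_mul]
      exact mul_le_mul (hGbound n ω) (norm_linearFun_le r _) (norm_nonneg _) (Real.exp_nonneg _)
    · filter_upwards [hGlim] with ω hω
      exact hω.mul_const _
  have heq : ∀ n : ℕ, ∫ ω, G n ω * linearFun r (Y t ω) ∂P =
      linearFun (((NormedSpace.exp (((n : ℂ) + 1)⁻¹ • ((t : ℂ) • jumpMatrix A)) *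
        NormedSpace.exp (((n : ℂ) + 1)⁻¹ • ((t : ℂ) • Matrix.diagonal V))) ^ (n + 1)).mulVec r)
        x := fun n => by
    have h1 := hY.integral_prod_mul_linearFun (t / (n + 1)) (fun i => Complex.exp (w n * V i))
      (n + 1) r
    rw [hgrid n] at h1
    have h2 : ((t / (n + 1) : ℝ≥0) : ℂ) • jumpMatrix A =
        ((n : ℂ) + 1)⁻¹ • ((t : ℂ) • jumpMatrix A) := by
      rw [smul_smul]
      congr 1
      push_cast
      ring
    have h3 : Matrix.diagonal (fun i => Complex.exp (w n * V i)) =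
        NormedSpace.exp (((n : ℂ) + 1)⁻¹ • ((t : ℂ) • Matrix.diagonal V)) := by
      rw [smul_smul, ← Matrix.diagonal_smul, Matrix.exp_diagonal, Pi.exp_def, Complex.exp_eq_exp_ℂ]
      rfl
    rw [h2, h3] at h1
    exact h1
  have hlim2 : Tendsto (fun n => ∫ ω, G n ω * linearFun r (Y t ω) ∂P) atTop
      (𝓝 (linearFun ((NormedSpace.exp ((t : ℂ) • jumpMatrix A +
        (t : ℂ) • Matrix.diagonal V)).mulVec r) x)) := by
    simp_rw [heq]
    -- the unit matrix has norm one only for `d > 0`, which the state `x` guarantees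
    have : Nonempty (Fin d) := ⟨x.2⟩
    have h1 : Tendsto (fun n : ℕ => (NormedSpace.exp (((n : ℂ) + 1)⁻¹ • ((t : ℂ) • jumpMatrix A)) *
        NormedSpace.exp (((n : ℂ) + 1)⁻¹ • ((t : ℂ) • Matrix.diagonal V))) ^ (n + 1)) atTop
        (𝓝 (NormedSpace.exp ((t : ℂ) • jumpMatrix A + (t : ℂ) • Matrix.diagonal V))) := by
      open scoped Matrix.Norms.Operator in
      exact tendsto_exp_mul_exp_pow _ _
    have h2 : Continuous fun N : Matrix (Fin d) (Fin d) ℂ => linearFun (N.mulVec r) x :=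
      continuous_const.mul
        ((continuous_apply x.2).comp (continuous_id.matrix_mulVec continuous_const))
    exact (h2.tendsto _).comp h1
  rw [tendsto_nhds_unique hlim1 hlim2, exp_jumpMatrix_add_diagonal, Matrix.smul_mulVec]
  change x.1 * (_ * _) = _ * (x.1 * _)
  exact mul_left_comm _ _ _

end

/-! ### The evolution equation on linear functions -/

/-- Differentiability passes through a continuous linear map into a space that need not be
normed. -/
theorem HasDerivWithinAt.continuousLinearMap_comp {E F : Type*} [AddCommGroup E] [Module ℝ E]
    [TopologicalSpace E] [ContinuousSMul ℝ E] [AddCommGroup F] [Module ℝ F] [TopologicalSpace F]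
    [ContinuousSMul ℝ F]
    (L : E →L[ℝ] F) {u : ℝ → E} {u' : E} {s : Set ℝ} {t : ℝ} (hu : HasDerivWithinAt u u' s t) :
    HasDerivWithinAt (fun t => L (u t)) (L u') s t := by
  refine ⟨((L.isBigOTVS_comp (f := _)).trans_isLittleOTVS hu.isLittleOTVS).congr_left fun p => ?_⟩
  simp

/-- The map `ρ ↦ f^ρ` into `C(S, ℂ)`. -/
noncomputable def linearFunCLM (d : ℕ) : (Fin d → ℂ) →L[ℝ] C(JumpState d, ℂ) :=
  LinearMap.toContinuousLinearMap
    { toFun := linearFun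
      map_add' := fun ρ σ => by
        ext x
        exact mul_add _ _ _
      map_smul' := fun c ρ => by
        ext x
        exact mul_smul_comm c x.1 (ρ x.2) }

/-- Evaluation at a point of the state space. -/
noncomputable def stateEvalCLM {d : ℕ} (x : JumpState d) : C(JumpState d, ℂ) →L[ℝ] ℂ where
  toFun f := f x
  map_add' _ _ := rfl
  map_smul' _ _ := rfl
  cont := continuous_eval_const x

section

variable {d : ℕ} (A : Matrix (Fin d) (Fin d) ℂ) (b : Fin d → ℂ) (z : ℂ)

/-- The explicit solution of the linear system on `ℂ^d` that the evolution equation becomes on the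
functions `f^ρ`. -/
noncomputable def linearFlow (r : Fin d → ℂ) (t : ℝ) : Fin d → ℂ :=
  Complex.exp (-t * ((d : ℂ) - 1)) •
    (NormedSpace.exp ((t : ℂ) • (A - z • Matrix.diagonal b))).mulVec r

theorem smul_linearFun (c : ℂ) (ρ : Fin d → ℂ) : c • linearFun ρ = linearFun (c • ρ) := by
  ext x
  exact (mul_smul_comm c x.1 (ρ x.2)).symm

/-- On the functions `f^ρ` the right-hand side of the evolution equation is the matrix
`A - zB - (d - 1)`. -/
theorem evolution_linearFun (ρ : Fin d → ℂ) :
    jumpGenerator A (linearFun ρ) + potentialMul A.diag (linearFun ρ) -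
        z • potentialMul b (linearFun ρ) =
      linearFun ((A - z • Matrix.diagonal b).mulVec ρ - ((d : ℂ) - 1) • ρ) := by
  rw [jumpGenerator_linearFun]
  ext x
  change x.1 * (jumpMatrix A).mulVec ρ x.2 + A.diag x.2 * (x.1 * ρ x.2) -
    z * (b x.2 * (x.1 * ρ x.2)) = x.1 * _
  simp only [jumpMatrix, Matrix.sub_mulVec, Matrix.smul_mulVec, Matrix.one_mulVec,
    Matrix.mulVec_diagonal, Pi.sub_apply, Pi.smul_apply, smul_eq_mul]
  ring

theorem hasDerivAt_linearFlow (r : Fin d → ℂ) (t : ℝ) :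
    HasDerivAt (linearFlow A b z r)
      ((A - z • Matrix.diagonal b).mulVec (linearFlow A b z r t) -
        ((d : ℂ) - 1) • linearFlow A b z r t) t := by
  set M := A - z • Matrix.diagonal b with hM
  have h1 : HasDerivAt (fun u : ℂ => (NormedSpace.exp (u • M)).mulVec r)
      (M.mulVec ((NormedSpace.exp ((t : ℂ) • M)).mulVec r)) (t : ℂ) := by
    open scoped Matrix.Norms.Operator in
    have h2 := hasDerivAt_exp_smul_const' (𝕂 := ℂ) M (t : ℂ)
    let Φ : Matrix (Fin d) (Fin d) ℂ →L[ℂ] (Fin d → ℂ) :=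
      LinearMap.toContinuousLinearMap ((Matrix.mulVecBilin ℂ ℂ).flip r)
    have h3 := Φ.hasFDerivAt.comp_hasDerivAt (t : ℂ) h2
    rw [Matrix.mulVec_mulVec]
    exact h3
  have h4 : HasDerivAt (fun u : ℂ => Complex.exp (-u * ((d : ℂ) - 1)))
      (Complex.exp (-(t : ℂ) * ((d : ℂ) - 1)) * (-((d : ℂ) - 1))) (t : ℂ) := by
    simpa using ((hasDerivAt_id (t : ℂ)).neg.mul_const ((d : ℂ) - 1)).cexp
  have h5 := (h4.smul h1).scomp t Complex.ofRealCLM.hasDerivAt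
  refine h5.congr_deriv ?_
  simp only [linearFlow, Matrix.mulVec_smul, smul_smul, Complex.ofRealCLM_apply, Complex.ofReal_one,
    one_smul, ← hM]
  rw [mul_neg, neg_smul, mul_comm ((d : ℂ) - 1)]
  exact (sub_eq_add_neg _ _).symm

theorem linearFlow_zero (r : Fin d → ℂ) : linearFlow A b z r 0 = r := by
  simp [linearFlow]

theorem isEvolutionSolution_linearFlow (r : Fin d → ℂ) :
    IsEvolutionSolution A b z (linearFun r) fun t => linearFun (linearFlow A b z r t) := by
  refine ⟨congrArg linearFun (linearFlow_zero A b z r), fun t _ => ?_⟩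
  rw [evolution_linearFun]
  exact (hasDerivAt_linearFlow A b z r t).hasDerivWithinAt.continuousLinearMap_comp (linearFunCLM d)

/-- Within the functions `f^ρ` the evolution equation is a linear ordinary differential equation on
`ℂ^d`, read off by evaluation at the points `(1, i)`; its solution is unique. -/
theorem IsEvolutionSolution.eq_linearFlow {A b z} {r : Fin d → ℂ} {w : ℝ → C(JumpState d, ℂ)}
    (hw : IsEvolutionSolution A b z (linearFun r) w)
    (hlin : ∀ t : ℝ, 0 ≤ t → ∃ ρ : Fin d → ℂ, w t = linearFun ρ) {t : ℝ} (ht : 0 ≤ t) :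
    w t = linearFun (linearFlow A b z r t) := by
  set ρ : ℝ → Fin d → ℂ := fun t i => w t (1, i) with hρ
  have hwρ : ∀ t, 0 ≤ t → w t = linearFun (ρ t) := fun t ht => by
    obtain ⟨σ, hσ⟩ := hlin t ht
    have : ρ t = σ := funext fun i => by
      simp only [hρ, hσ]
      exact one_mul _
    rw [this, hσ]
  let v : (Fin d → ℂ) →L[ℂ] (Fin d → ℂ) := LinearMap.toContinuousLinearMap
    ((A - z • Matrix.diagonal b).mulVecLin - ((d : ℂ) - 1) • LinearMap.id)
  have hρd : ∀ t, 0 ≤ t → HasDerivWithinAt ρ (v (ρ t)) (Set.Ici 0) t := fun t ht => by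
    refine hasDerivWithinAt_pi.2 fun i => ?_
    have h1 := (hw.2 t ht).continuousLinearMap_comp (stateEvalCLM (1, i))
    rw [hwρ t ht, evolution_linearFun] at h1
    refine h1.congr_deriv ?_
    exact one_mul _
  have h0 : ρ 0 = linearFlow A b z r 0 := by
    rw [linearFlow_zero]
    funext i
    simp only [hρ, hw.1]
    exact one_mul _
  have huniq := ODE_solution_unique_of_mem_Icc_right (v := fun _ => v) (s := fun _ => Set.univ)
    (a := 0) (b := t) (f := ρ) (g := linearFlow A b z r) (K := ‖v‖₊)
    (fun _ _ => v.lipschitz.lipschitzOnWith)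
    (fun s hs => ((hρd s hs.1).continuousWithinAt).mono fun u hu => hu.1)
    (fun s hs => (hρd s hs.1).mono fun u hu => hs.1.trans hu) (fun _ _ => Set.mem_univ _)
    (fun s _ => (hasDerivAt_linearFlow A b z r s).continuousAt.continuousWithinAt)
    (fun s _ => (hasDerivAt_linearFlow A b z r s).hasDerivWithinAt) (fun _ _ => Set.mem_univ _) h0
  rw [hwρ t ht, huniq ⟨ht, le_rfl⟩]

end
theorem theorem6p3 {d : ℕ} (A : Matrix (Fin d) (Fin d) ℂ) (b : Fin d → ℂ)
    {Ω : JumpState d → Type*} {m : ∀ x, MeasurableSpace (Ω x)} (P : ∀ x, Measure (Ω x))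
    (ℱ : ∀ x, Filtration ℝ≥0 (m x)) (Y : ∀ x, ℝ≥0 → Ω x → JumpState d)
    (hY : ∀ x, IsMarkovProcessWithGenerator (jumpGenerator A) x (P x) (ℱ x) (Y x))
    (z : ℂ) (r : Fin d → ℂ) :
    -- the expectations exist
    (∀ t : ℝ, 0 ≤ t → ∀ x, Integrable (feynmanKacFunctional A.diag b z r (Y x) t) (P x)) ∧
    -- the expectation `u_t^r(ζ, i)` solves the differential equation with initial value `f^r`
    (∃ u : ℝ → C(JumpState d, ℂ),
      (∀ t : ℝ, 0 ≤ t → ∀ x, u t x = ∫ ω, feynmanKacFunctional A.diag b z r (Y x) t ω ∂(P x)) ∧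
      IsEvolutionSolution A b z (linearFun r) u) ∧
    -- `t ↦ e^{-t(d-1)} f^{exp(t(A-zB))r}` solves it
    IsEvolutionSolution A b z (linearFun r) (fun t : ℝ =>
      Complex.exp (-t * ((d : ℂ) - 1)) •
        linearFun ((NormedSpace.exp ((t : ℂ) • (A - z • Matrix.diagonal b))).mulVec r)) ∧
    -- and is the only solution with values in the space of the functions `f^ρ`
    (∀ w : ℝ → C(JumpState d, ℂ), IsEvolutionSolution A b z (linearFun r) w →
      (∀ t : ℝ, 0 ≤ t → ∃ ρ : Fin d → ℂ, w t = linearFun ρ) →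
      ∀ t : ℝ, 0 ≤ t → w t = Complex.exp (-t * ((d : ℂ) - 1)) •
        linearFun ((NormedSpace.exp ((t : ℂ) • (A - z • Matrix.diagonal b))).mulVec r)) ∧
    -- the resulting formula
    (∀ t : ℝ, 0 ≤ t → ∀ i : Fin d,
      ∫ ω, feynmanKacFunctional A.diag b z r (Y (1, i)) t ω ∂(P (1, i)) =
        Complex.exp (-t * ((d : ℂ) - 1)) *
          (NormedSpace.exp ((t : ℂ) • (A - z • Matrix.diagonal b))).mulVec r i) := by
  have hsol := isEvolutionSolution_linearFlow A b z r
  have hform : ∀ t : ℝ, 0 ≤ t → ∀ x,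
      Integrable (feynmanKacFunctional A.diag b z r (Y x) t) (P x) ∧
        linearFun (linearFlow A b z r t) x =
          ∫ ω, feynmanKacFunctional A.diag b z r (Y x) t ω ∂(P x) := fun t ht x => by
    lift t to ℝ≥0 using ht
    have h1 := (hY x).feynmanKac b z r t
    refine ⟨h1.1, ?_⟩
    rw [h1.2, linearFlow, ← smul_linearFun]
    rfl
  simp_rw [smul_linearFun]
  refine ⟨fun t ht x => (hform t ht x).1, ⟨_, fun t ht x => (hform t ht x).2, hsol⟩, hsol,
    fun w hw hlin t ht => hw.eq_linearFlow hlin ht, fun t ht i => ?_⟩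
  rw [← (hform t ht (1, i)).2]
  exact one_mul _
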